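/- Corollary 3.6. Let $\mathbb F\in\{\mathbb R,\mathbb C\}$ and let $X$ be a Tychonoff space. Call $A\subseteq X$ functionally bounded if every continuous $f:X\to\mathbb R$ is bounded on $A$, and call $X$ a $\mu$-space if every functionally bounded subset of $X$ has compact closure. A topological space $K$ is selectively sequentially pseudocompact if for all non-empty open sets $U_n\subseteq K$ ($n\in\mathbb N$) there are points $x_n\in U_n$ such that $(x_n)$ has a subsequence converging in $K$. Let $C_p(X)$ and $C_k(X)$ be the space of all continuous functions $X\to\mathbb F$ with the topology of pointwise convergence and with the compact-open topology, respectively. For a locally convex space $E$ over $\mathbb F$, a barrel is a closed, absolutely convex, absorbing subset of $E$. A set $A\subseteq E$ is barrel-bounded if for every barrel $U$ there is $n\in\mathbb N$ with $A\subseteq nU$, and barrel-precompact if for every barrel $U$ there is a finite $F\subseteq E$ with $A\subseteq F+U$. A set $A\subseteq E$ is limited if it is barrel-bounded and every weak$^*$ null sequence in the topological dual $E'$ converges to $0$ uniformly on $A$. The space $E$ is Gelfand–Phillips if every limited subset of $E$ is barrel-precompact. (a) If $X$ is a $\mu$-space and every compact subspace of $X$ is selectively sequentially pseudocompact, then both $C_p(X)$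 and $C_k(X)$ are Gelfand–Phillips. (b) Every metrizable space $X$ satisfies the hypotheses of (a): it is a $\mu$-space all of whose compact subspaces are selectively sequentially pseudocompact. Hence $C_p(X)$ and $C_k(X)$ are Gelfand–Phillips for metrizable $X$. -/

import Mathlib

open Filter Topology
open scoped Pointwise

section Spaces

/-- `X` is selectively sequentially pseudocompact at `A`: for any open sets `U n` meeting `A` one
can choose points `x n ∈ U n` so that the sequence `x` has a subsequence that converges in `X`. -/
def SelSeqPseudocompactAt (X : Type*) [TopologicalSpace X] (A : Set X) : Prop :=
  ∀ U : ℕ → Set X, (∀ n, IsOpen (U n)) → (∀ n, (U n ∩ A).Nonempty) →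
    ∃ x : ℕ → X, (∀ n, x n ∈ U n) ∧
      ∃ φ : ℕ → ℕ, StrictMono φ ∧ ∃ l : X, Tendsto (x ∘ φ) atTop (𝓝 l)

/-- `X` is selectively sequentially pseudocompact: it is so at the whole of `X`. -/
def SelSeqPseudocompact (X : Type*) [TopologicalSpace X] : Prop :=
  SelSeqPseudocompactAt X Set.univ

/-- A subset of `X` is functionally bounded if every continuous real-valued function on `X`
is bounded on it. -/
def FunctionallyBounded {X : Type*} [TopologicalSpace X] (A : Set X) : Prop :=
  ∀ f : C(X, ℝ), Bornology.IsBounded (f '' A)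

/-- A (Tychonoff) space is a `μ`-space if all of its functionally bounded subsets have compact
closure. -/
def IsMuSpace (X : Type*) [TopologicalSpace X] : Prop :=
  ∀ A : Set X, FunctionallyBounded A → IsCompact (closure A)

end Spaces

section LocallyConvex

variable (𝕜 : Type*) [RCLike 𝕜] {E : Type*} [AddCommGroup E] [Module 𝕜 E] [Module ℝ E]
  [IsScalarTower ℝ 𝕜 E] [TopologicalSpace E]

/-- A barrel: a closed, absolutely convex, absorbing set. -/
structure IsBarrel (B : Set E) : Prop where
  isClosed : IsClosed B
  balanced : Balanced 𝕜 B
  convex : Convex ℝ B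
  absorbent : Absorbent 𝕜 B

/-- Boundedness in the topology `β(E, E')`, for which the barrels of `E` form a neighborhood base
at zero. -/
def BarrelBounded (A : Set E) : Prop :=
  ∀ U : Set E, IsBarrel 𝕜 U → ∃ n : ℕ, A ⊆ (n : 𝕜) • U

/-- Precompactness in the topology `β(E, E')`, for which the barrels of `E` form a neighborhood
base at zero. -/
def BarrelPrecompact (A : Set E) : Prop :=
  ∀ U : Set E, IsBarrel 𝕜 U → ∃ F : Set E, F.Finite ∧ A ⊆ F + U

/-- A limited set: a barrel-bounded set on which every weak* null sequence of continuous linear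
functionals converges to zero uniformly. -/
def IsLimitedSet (A : Set E) : Prop :=
  BarrelBounded 𝕜 A ∧
    ∀ χ : ℕ → WeakDual 𝕜 E, Tendsto χ atTop (𝓝 0) →
      TendstoUniformlyOn (fun n x => χ n x) (fun _ => (0 : 𝕜)) atTop A

variable (E) in
/-- The Gelfand--Phillips property of the locally convex space `E` over `𝕜`: every limited subset
is barrel-precompact. -/
def GelfandPhillips : Prop :=
  ∀ A : Set E, IsLimitedSet 𝕜 A → BarrelPrecompact 𝕜 A

end LocallyConvex

section FunctionSpaces

/-- `C_p(X)`: the space of all continuous functions `X → 𝕜`, as a topological vector subspace of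
the product `X → 𝕜`, i.e. with the topology of pointwise convergence. -/
abbrev Cp (X 𝕜 : Type*) [TopologicalSpace X] [RCLike 𝕜] : Type _ :=
  ↥(continuousSubmodule X 𝕜 𝕜)

/-- `C_k(X)`: the space of all continuous functions `X → 𝕜` with the compact-open topology, which
is the topology that Mathlib puts on `C(X, 𝕜)`. -/
abbrev Ck (X 𝕜 : Type*) [TopologicalSpace X] [RCLike 𝕜] : Type _ := C(X, 𝕜)

end FunctionSpaces

/-! Let `A` be limited and `U` a barrel, in either topology. The identity from the compact-open
topology is continuous, so `U` is a barrel there too, and by Nachbin–Shirota it contains all `f`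
with `‖f‖ < ε` on some compact `K`. It remains to find a finite uniform `ε / 2`-net for `A`
restricted to `K`. If `x n → l` in `K`, the evaluations at `x n` minus that at `l` are weak* null,
so limitedness makes `f (x n) → f l` uniformly over `f ∈ A`. Selective sequential pseudocompactness
then makes `K` totally bounded for the pseudometric `sup_{f ∈ A} |f x - f y|`, and an Arzelà–Ascoli
argument gives the net. Nachbin–Shirota rests on Baire category: a barrel of a Baire space is a
neighborhood of zero. This is applied to pullbacks to `ℕ → 𝕜` (the support of a barrel is
functionally bounded) and to the bounded functions. -/

/-! ### Barrels and Baire category -/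

namespace IsBarrel

variable {𝕜 : Type*} [RCLike 𝕜] {E F : Type*} [AddCommGroup E] [Module 𝕜 E] [Module ℝ E]
  [IsScalarTower ℝ 𝕜 E] [TopologicalSpace E] [AddCommGroup F] [Module 𝕜 F] [Module ℝ F]
  [IsScalarTower ℝ 𝕜 F] [TopologicalSpace F]

/-- Barrels pull back along continuous linear maps. -/
theorem preimage {B : Set F} (hB : IsBarrel 𝕜 B) (T : E →ₗ[𝕜] F) (hT : Continuous T) :
    IsBarrel 𝕜 (T ⁻¹' B) where
  isClosed := hB.isClosed.preimage hT
  balanced := by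
    rw [balanced_iff_smul_mem]
    intro a ha x hx
    simpa using hB.balanced.smul_mem ha hx
  convex := hB.convex.linear_preimage (T.restrictScalars ℝ)
  absorbent := by
    intro x
    have h := hB.absorbent (T x)
    rw [absorbs_iff_eventually_cobounded_mapsTo] at h ⊢
    filter_upwards [h] with c hc
    intro y hy
    simpa [Set.mem_singleton_iff.1 hy] using hc (Set.mem_singleton _)

omit [IsScalarTower ℝ 𝕜 E] in
theorem exists_natCast_mem {B : Set E} (hB : IsBarrel 𝕜 B) (x : E) :
    ∃ n : ℕ, x ∈ ((n + 1 : ℕ) : 𝕜) • B := by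
  have h : Tendsto (fun n : ℕ => ((n + 1 : ℕ) : 𝕜)) atTop (Bornology.cobounded 𝕜) := by
    rw [← tendsto_norm_atTop_iff_cobounded]
    simp only [RCLike.norm_natCast]
    exact tendsto_natCast_atTop_atTop.comp (tendsto_add_atTop_nat 1)
  obtain ⟨n, hn⟩ := (h.eventually (hB.absorbent x)).exists
  exact ⟨n, hn (Set.mem_singleton _)⟩

omit [IsScalarTower ℝ 𝕜 E] in
theorem nonempty {B : Set E} (hB : IsBarrel 𝕜 B) : B.Nonempty := by
  obtain ⟨n, y, hy, -⟩ := hB.exists_natCast_mem 0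
  exact ⟨y, hy⟩

omit [IsScalarTower ℝ 𝕜 E] in
theorem zero_mem {B : Set E} (hB : IsBarrel 𝕜 B) : (0 : E) ∈ B :=
  hB.balanced.zero_mem hB.nonempty

theorem add_mem {B : Set E} (hB : IsBarrel 𝕜 B) {x y : E} (hx : (2 : 𝕜) • x ∈ B)
    (hy : (2 : 𝕜) • y ∈ B) : x + y ∈ B := by
  have h := hB.convex hx hy (a := 1 / 2) (b := 1 / 2) (by norm_num) (by norm_num) (by norm_num)
  have key : ∀ z : E, (1 / 2 : ℝ) • (2 : 𝕜) • z = z := fun z => by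
    rw [← algebraMap_smul 𝕜 (1 / 2 : ℝ), smul_smul, map_div₀, map_one, map_ofNat,
      one_div_mul_cancel two_ne_zero, one_smul]
  rwa [key, key] at h

/-- In a Baire topological vector space every barrel is a neighborhood of zero. -/
theorem mem_nhds_zero {B : Set E} (hB : IsBarrel 𝕜 B) [IsTopologicalAddGroup E]
    [ContinuousConstSMul 𝕜 E] [BaireSpace E] : B ∈ 𝓝 (0 : E) := by
  have hne : ∀ n : ℕ, ((n + 1 : ℕ) : 𝕜) ≠ 0 := fun n => Nat.cast_ne_zero.2 n.succ_ne_zero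
  -- Some dilate of `B` has an interior point `x = (n + 1) • a`. For `y = (n + 1) • b` in this
  -- dilate, `(y - x) / (2 (n + 1))` is the midpoint of `b` and `-a`, hence in `B`.
  obtain ⟨n, x, hx⟩ := nonempty_interior_of_iUnion_of_closed
    (f := fun n : ℕ => ((n + 1 : ℕ) : 𝕜) • B)
    (fun n => hB.isClosed.smul_of_ne_zero (hne n))
    (Set.eq_univ_of_forall fun x => Set.mem_iUnion.2 (hB.exists_natCast_mem x))
  rw [mem_interior_iff_mem_nhds] at hx
  have hsub : ∀ y ∈ ((n + 1 : ℕ) : 𝕜) • B, (1 / (2 * (n + 1 : ℕ)) : 𝕜) • (y - x) ∈ B := by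
    intro y hy
    obtain ⟨b, hb, rfl⟩ := hy
    obtain ⟨a, ha, rfl⟩ := mem_of_mem_nhds hx
    have hna : -a ∈ B := by simpa using hB.balanced.smul_mem (a := (-1 : 𝕜)) (by simp) ha
    have h2 : ∀ z : E, (2 : 𝕜) • (1 / 2 : 𝕜) • z = z := fun z => by rw [smul_smul]; simp
    have := hB.add_mem (x := (1 / 2 : 𝕜) • b) (y := (1 / 2 : 𝕜) • -a) (by rwa [h2])
      (by rwa [h2])
    convert this using 1
    have h3 : (1 / (2 * (n + 1 : ℕ)) : 𝕜) * (n + 1 : ℕ) = 1 / 2 := by field_simp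
    change (1 / (2 * (n + 1 : ℕ)) : 𝕜) • (((n + 1 : ℕ) : 𝕜) • b - ((n + 1 : ℕ) : 𝕜) • a) = _
    rw [← smul_sub, smul_smul, h3, ← smul_add, sub_eq_add_neg]
  have hcont : Tendsto (fun z : E => x + (2 * (n + 1 : ℕ) : 𝕜) • z) (𝓝 0) (𝓝 x) := by
    have : Continuous (fun z : E => x + (2 * (n + 1 : ℕ) : 𝕜) • z) := by fun_prop
    simpa using this.tendsto 0
  filter_upwards [hcont hx] with z hz
  have := hsub _ hz
  rw [add_sub_cancel_left, smul_smul, one_div_mul_cancel (mul_ne_zero two_ne_zero (hne n)),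
    one_smul] at this
  exact this

end IsBarrel

/-! ### The Nachbin–Shirota theorem -/

section NachbinShirota

variable {𝕜 : Type*} [RCLike 𝕜] {X : Type*} [TopologicalSpace X]

/-- A closed set in the compact-open topology contains every function that agrees on each compact
set with some member of it. -/
theorem ContinuousMap.mem_of_isClosed_of_forall_eqOn {B : Set C(X, 𝕜)} (hB : IsClosed B)
    {f : C(X, 𝕜)} (h : ∀ L : Set X, IsCompact L → ∃ g ∈ B, Set.EqOn g f L) : f ∈ B := by
  rw [← hB.closure_eq, mem_closure_iff_nhds_basis (ContinuousMap.hasBasis_nhds f)]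
  rintro S ⟨hS, hSf⟩
  obtain ⟨g, hg, hgf⟩ := h (⋃ p ∈ S, p.1) (hS.isCompact_biUnion fun p hp => (hSf p.1 p.2 hp).1)
  refine ⟨g, hg, ?_⟩
  simp only [Set.mem_iInter, Set.mem_ofPred_eq]
  intro p hp x hx
  rw [hgf (Set.mem_biUnion hp hx)]
  exact (hSf p.1 p.2 hp).2.2 hx

/-- The continuous linear map sending a sequence of coefficients `c` to `∑ c n • f n`, for a
locally finite sequence of continuous functions `f`. -/
noncomputable def ContinuousMap.locallyFiniteSum (f : ℕ → C(X, 𝕜))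
    (hf : LocallyFinite fun n => Function.support (f n)) : (ℕ → 𝕜) →ₗ[𝕜] C(X, 𝕜) where
  toFun c :=
    { toFun := fun x => ∑ᶠ n, c n * f n x
      continuous_toFun := continuous_finsum (fun n => by fun_prop)
        (hf.subset fun n x hx => right_ne_zero_of_mul hx) }
  map_add' c d := by
    have hfin : ∀ (c : ℕ → 𝕜) (x : X), Function.HasFiniteSupport fun n => c n * f n x :=
      fun c x => (hf.point_finite x).subset fun n hn => right_ne_zero_of_mul hn
    ext x
    simp only [ContinuousMap.coe_mk, ContinuousMap.add_apply, Pi.add_apply, add_mul]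
    exact finsum_add_distrib (hfin c x) (hfin d x)
  map_smul' a c := by
    ext x
    simp only [ContinuousMap.coe_mk, ContinuousMap.smul_apply, Pi.smul_apply, RingHom.id_apply,
      smul_eq_mul, mul_assoc]
    exact (mul_finsum' _ _ ((hf.point_finite x).subset fun n hn => right_ne_zero_of_mul hn)).symm

/-- By currying, joint continuity in `(c, x)` suffices, and local finiteness pulls back along the
projection to `X`. -/
theorem ContinuousMap.continuous_locallyFiniteSum (f : ℕ → C(X, 𝕜))
    (hf : LocallyFinite fun n => Function.support (f n)) :
    Continuous (ContinuousMap.locallyFiniteSum f hf) := by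
  refine ContinuousMap.continuous_of_continuous_uncurry _ ?_
  change Continuous fun p : (ℕ → 𝕜) × X => ∑ᶠ n, p.1 n * f n p.2
  refine continuous_finsum (fun n => by fun_prop) ?_
  exact (hf.preimage_continuous continuous_snd).subset fun n p hp => right_ne_zero_of_mul hp

theorem ContinuousMap.locallyFiniteSum_single (f : ℕ → C(X, 𝕜))
    (hf : LocallyFinite fun n => Function.support (f n)) (n : ℕ) :
    ContinuousMap.locallyFiniteSum f hf (Pi.single n 1) = f n := by
  ext x
  change ∑ᶠ m, (Pi.single n 1 : ℕ → 𝕜) m * f m x = f n x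
  rw [finsum_eq_single _ n fun m hm => by simp [hm]]
  simp

/-- A barrel contains all but finitely many members of a locally finite sequence. -/
theorem IsBarrel.eventually_mem_of_locallyFinite {B : Set C(X, 𝕜)} (hB : IsBarrel 𝕜 B)
    {f : ℕ → C(X, 𝕜)} (hf : LocallyFinite fun n => Function.support (f n)) :
    ∀ᶠ n in atTop, f n ∈ B := by
  -- The product `ℕ → 𝕜` is Baire, and its unit vectors tend to zero.
  have h := (hB.preimage _ (ContinuousMap.continuous_locallyFiniteSum f hf)).mem_nhds_zero
  have hlim : Tendsto (fun n : ℕ => (Pi.single n 1 : ℕ → 𝕜)) atTop (𝓝 0) := by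
    rw [tendsto_pi_nhds]
    intro m
    refine tendsto_const_nhds.congr' ?_
    filter_upwards [eventually_gt_atTop m] with n hn
    simp [hn.ne]
  filter_upwards [hlim h] with n hn
  rwa [Set.mem_preimage, Set.mem_preimage, ContinuousMap.locallyFiniteSum_single] at hn

/-- The support of a set `B` of functions: the points near which there are functions supported
outside of `B`. -/
def functionSetSupport (B : Set C(X, 𝕜)) : Set X :=
  {x | ∀ U ∈ 𝓝 x, ∃ f : C(X, 𝕜), (∀ y ∉ U, f y = 0) ∧ f ∉ B}

/-- If `h` were unbounded on the support, there would be `f n ∉ B` vanishing off `{|h| > n}`. Such a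
sequence is locally finite, since `h` is locally bounded, so almost all `f n` would lie in `B`. -/
theorem IsBarrel.functionallyBounded_functionSetSupport {B : Set C(X, 𝕜)} (hB : IsBarrel 𝕜 B) :
    FunctionallyBounded (functionSetSupport B) := by
  intro h
  by_contra hun
  have hx : ∀ n : ℕ, ∃ x ∈ functionSetSupport B, (n : ℝ) < |h x| := by
    intro n
    by_contra! hn
    refine hun (isBounded_iff_forall_norm_le.2 ⟨n, ?_⟩)
    rintro _ ⟨x, hx, rfl⟩
    exact hn x hx
  choose x hxS hx using hx
  have hU : ∀ n : ℕ, {y | (n : ℝ) < |h y|} ∈ 𝓝 (x n) := fun n =>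
    (isOpen_lt continuous_const (by fun_prop)).mem_nhds (hx n)
  choose f hf hfB using fun n => hxS n _ (hU n)
  have hlf : LocallyFinite fun n => Function.support (f n) := by
    intro y
    obtain ⟨N, hN⟩ := exists_nat_gt |h y|
    refine ⟨{z | |h z| < N}, (isOpen_lt (by fun_prop) continuous_const).mem_nhds hN,
      (Set.finite_lt_nat N).subset ?_⟩
    rintro n ⟨z, hz, hzN⟩
    have h1 : (n : ℝ) < |h z| := by
      by_contra hlt
      exact hz (hf n z hlt)
    exact_mod_cast h1.trans hzN
  obtain ⟨n, hn⟩ := (hB.eventually_mem_of_locallyFinite hlf).exists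
  exact hfB n hn

/-- The largest linear subspace inside a barrel. -/
def IsBarrel.kernel {B : Set C(X, 𝕜)} (hB : IsBarrel 𝕜 B) : Submodule 𝕜 C(X, 𝕜) where
  carrier := {f | ∀ c : 𝕜, c • f ∈ B}
  add_mem' {f g} hf hg c := by
    have h : c • (f + g) = c • f + c • g := smul_add c f g
    rw [h]
    exact hB.add_mem (by rw [smul_smul]; exact hf _) (by rw [smul_smul]; exact hg _)
  zero_mem' c := by rw [smul_zero]; exact hB.zero_mem
  smul_mem' a f hf c := by rw [smul_smul]; exact hf _

/-- A barrel contains the functions vanishing in a neighborhood of its support. -/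
theorem IsBarrel.mem_of_eq_zero_nhds [CompletelyRegularSpace X] {B : Set C(X, 𝕜)}
    (hB : IsBarrel 𝕜 B) {W : Set X} (hW : IsOpen W) (hSW : functionSetSupport B ⊆ W)
    {f : C(X, 𝕜)} (hf : ∀ x ∈ W, f x = 0) : f ∈ B := by
  refine ContinuousMap.mem_of_isClosed_of_forall_eqOn hB.isClosed fun L hL => ?_
  -- Near a point off the support all functions with small support lie in `B`, as do their scalar
  -- multiples. They thus lie in the kernel, which, unlike `B`, is closed under sums.
  have hbump : ∀ x ∈ L \ W, ∃ φ : C(X, ℝ), 1 / 2 < φ x ∧ (∀ y, 0 ≤ φ y) ∧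
      ∀ ψ : C(X, 𝕜), ψ * ⟨fun y => (φ y : 𝕜), by fun_prop⟩ ∈ hB.kernel := by
    intro x hx
    have hxS : x ∉ functionSetSupport B := fun h => hx.2 (hSW h)
    simp only [functionSetSupport, Set.mem_ofPred_eq, not_forall, not_exists, not_and,
      not_not] at hxS
    obtain ⟨U, hU, hUB⟩ := hxS
    obtain ⟨V, hVU, hVo, hxV⟩ := mem_nhds_iff.1 hU
    obtain ⟨p, hp, hpx, hpV⟩ := CompletelyRegularSpace.completely_regular x Vᶜ hVo.isClosed_compl
      (not_not.2 hxV)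
    refine ⟨⟨fun y => 1 - p y, by fun_prop⟩, by simp [hpx]; norm_num, fun y => ?_, fun ψ c => ?_⟩
    · simpa using (p y).2.2
    · refine hUB _ fun y hy => ?_
      have : p y = 1 := hpV fun h => hy (hVU h)
      simp [this]
  choose! φ hφx hφ0 hφB using hbump
  have hcomp : IsCompact (L \ W) := hL.diff hW
  obtain ⟨t, ht, hcov⟩ := hcomp.elim_nhds_subcover (fun x => {y | 1 / 2 < φ x y}) fun x hx =>
    (isOpen_lt continuous_const (φ x).continuous).mem_nhds (hφx x hx)
  set s : C(X, ℝ) := ∑ x ∈ t, φ x with hs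
  -- The maximum permits division everywhere and equals `s` on `L \ W`; on `W` the factor `f`
  -- vanishes anyway.
  have hpos : ∀ y, 0 < max (s y) (1 / 2) := fun y => lt_max_of_lt_right (by norm_num)
  let r : C(X, 𝕜) := ⟨fun y => ((max (s y) (1 / 2))⁻¹ : ℝ),
    RCLike.continuous_ofReal.comp
      ((s.continuous.max continuous_const).inv₀ fun y => (hpos y).ne')⟩
  let φ' : X → C(X, 𝕜) := fun x => ⟨fun y => (φ x y : 𝕜), by fun_prop⟩
  refine ⟨∑ x ∈ t, (f * r) * φ' x, ?_, fun y hy => ?_⟩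
  · have := hB.kernel.sum_mem fun x hx => hφB x (ht x hx) (f * r)
    simpa using this 1
  · rw [← Finset.mul_sum, ContinuousMap.mul_apply, ContinuousMap.mul_apply]
    by_cases hyW : y ∈ W
    · simp [hf y hyW]
    · obtain ⟨x, hxt, hxy⟩ := Set.mem_iUnion₂.1 (hcov ⟨hy, hyW⟩)
      have hsy : s y = ∑ x ∈ t, φ x y := by simp [hs]
      have hle : 1 / 2 ≤ s y := by
        rw [hsy]
        exact (le_of_lt hxy).trans
          (Finset.single_le_sum (f := fun x => φ x y) (fun z hz => hφ0 z (ht z hz) y) hxt)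
      have h1 : (∑ x ∈ t, φ' x) y = (s y : 𝕜) := by
        rw [hsy]
        simp [φ']
      have h2 : r y = ((s y)⁻¹ : ℝ) := by
        simp only [r, ContinuousMap.coe_mk, max_eq_left hle]
      have h3 : (s y : 𝕜) ≠ 0 := RCLike.ofReal_ne_zero.2 (by linarith)
      rw [h1, h2, mul_assoc, RCLike.ofReal_inv, inv_mul_cancel₀ h3, mul_one]

/-- A barrel contains all functions of sufficiently small sup norm. -/
theorem IsBarrel.exists_norm_le_imp_mem {B : Set C(X, 𝕜)} (hB : IsBarrel 𝕜 B) :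
    ∃ δ > 0, ∀ f : C(X, 𝕜), (∀ x, ‖f x‖ ≤ δ) → f ∈ B := by
  let T : BoundedContinuousFunction X 𝕜 →ₗ[𝕜] C(X, 𝕜) :=
    { toFun := fun f => f.toContinuousMap
      map_add' := fun _ _ => rfl
      map_smul' := fun _ _ => rfl }
  have hT : Continuous T := by
    refine ContinuousMap.continuous_of_continuous_uncurry _ ?_
    exact continuous_eval
  -- The bounded continuous functions form a Banach space, hence a Baire space.
  obtain ⟨δ, hδ, h⟩ := Metric.nhds_basis_closedBall.mem_iff.1 (hB.preimage T hT).mem_nhds_zero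
  refine ⟨δ, hδ, fun f hf => ?_⟩
  have : BoundedContinuousFunction.ofNormedAddCommGroup f f.continuous δ hf ∈ T ⁻¹' B := by
    refine h (mem_closedBall_zero_iff.2 ?_)
    exact BoundedContinuousFunction.norm_ofNormedAddCommGroup_le _ hδ.le hf
  exact this

/-- **Nachbin--Shirota theorem**: if `X` is a `μ`-space, then every barrel of the space of
continuous functions with the compact-open topology is a neighborhood of zero. -/
theorem IsBarrel.exists_isCompact_of_isMuSpace [CompletelyRegularSpace X] (hX : IsMuSpace X)
    {B : Set C(X, 𝕜)} (hB : IsBarrel 𝕜 B) :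
    ∃ K : Set X, IsCompact K ∧ ∃ ε > 0, ∀ f : C(X, 𝕜), (∀ x ∈ K, ‖f x‖ < ε) → f ∈ B := by
  obtain ⟨δ, hδ, hδB⟩ := hB.exists_norm_le_imp_mem
  refine ⟨_, hX _ hB.functionallyBounded_functionSetSupport, δ / 2, half_pos hδ, fun f hf => ?_⟩
  -- `r * f` is the radial truncation of `f` at height `δ / 2`. The remainder `f - r * f` vanishes
  -- on the open set `{‖f‖ < δ / 2}`, which contains the support of `B`.
  have hpos : ∀ x, 0 < max (δ / 2) ‖f x‖ := fun x => lt_max_of_lt_left (half_pos hδ)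
  let r : C(X, 𝕜) := ⟨fun x => ((δ / 2 / max (δ / 2) ‖f x‖ : ℝ) : 𝕜),
    RCLike.continuous_ofReal.comp (continuous_const.div
      (continuous_const.max f.continuous.norm) fun x => (hpos x).ne')⟩
  have hr : ∀ x, ‖r x‖ = δ / 2 / max (δ / 2) ‖f x‖ := fun x => by
    simp only [r, ContinuousMap.coe_mk, RCLike.norm_ofReal]
    exact abs_of_pos (div_pos (half_pos hδ) (hpos x))
  have h1 : (2 : 𝕜) • (r * f) ∈ B := by
    refine hδB _ fun x => ?_
    rw [ContinuousMap.smul_apply, ContinuousMap.mul_apply, norm_smul, norm_mul, hr,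
      RCLike.norm_ofNat, div_mul_eq_mul_div, ← le_div_iff₀' two_pos, div_le_iff₀ (hpos x)]
    exact mul_le_mul_of_nonneg_left (le_max_right _ _) (half_pos hδ).le
  have h2 : (2 : 𝕜) • (f - r * f) ∈ B := by
    refine hB.mem_of_eq_zero_nhds (W := {x | ‖f x‖ < δ / 2})
      (isOpen_lt f.continuous.norm continuous_const) (fun x hx => hf x (subset_closure hx))
      fun x hx => ?_
    have hx' : r x = 1 := by
      simp only [r, ContinuousMap.coe_mk]
      rw [max_eq_left (show _ from hx : ‖f x‖ < δ / 2).le, div_self (half_pos hδ).ne',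
        RCLike.ofReal_one]
    simp [hx']
  simpa using hB.add_mem h1 h2

end NachbinShirota

/-! ### Metrizable spaces -/

/-- A functionally bounded subset of a metrizable space has compact closure: otherwise it contains
a sequence without cluster points, on which some continuous function is unbounded. -/
theorem isMuSpace_of_metrizableSpace (X : Type*) [TopologicalSpace X]
    [TopologicalSpace.MetrizableSpace X] : IsMuSpace X := by
  intro A hA
  let _ := TopologicalSpace.metrizableSpaceMetric X
  refine IsSeqCompact.isCompact fun u hu => ?_
  by_cases hc : ∃ x, MapClusterPt x atTop u
  · obtain ⟨x, hx⟩ := hc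
    obtain ⟨φ, hφ, hlim⟩ := hx.tendsto_subseq
    exact ⟨x, isClosed_closure.mem_of_tendsto hlim (Eventually.of_forall fun n => hu _),
      φ, hφ, hlim⟩
  push Not at hc
  exfalso
  -- A partition of unity yields `g` with `g (u m) ≥ m` for all `m`. Locally a constant `N` works,
  -- because near a non-cluster point only terms `u m` with `m < N` occur.
  obtain ⟨g, hg⟩ := exists_continuous_forall_mem_convex_of_local_const
    (t := fun y : X => ⋂ m : {m : ℕ // u m = y}, Set.Ici ((m : ℕ) : ℝ))
    (fun y => convex_iInter fun m => convex_Ici _) (fun x => by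
      have := hc x
      rw [mapClusterPt_iff_frequently] at this
      push Not at this
      obtain ⟨s, hs, hN⟩ := this
      rw [eventually_atTop] at hN
      obtain ⟨N, hN⟩ := hN
      refine ⟨N, ?_⟩
      filter_upwards [hs] with y hy
      rw [Set.mem_iInter]
      rintro ⟨m, rfl⟩
      by_contra hlt
      simp only [Set.mem_Ici, not_le, Nat.cast_lt] at hlt
      exact hN m hlt.le hy)
  have hb : Bornology.IsBounded (g '' closure A) :=
    (hA g).closure.subset (image_closure_subset_closure_image g.continuous)
  obtain ⟨C, hC⟩ := hb.exists_norm_le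
  obtain ⟨n, hn⟩ := exists_nat_gt C
  have h1 : (n : ℝ) ≤ g (u n) := Set.mem_iInter.1 (hg (u n)) ⟨n, rfl⟩
  have h2 := hC _ (Set.mem_image_of_mem g (hu n))
  exact absurd (h1.trans ((le_abs_self _).trans h2)) (not_le.2 hn)

theorem selSeqPseudocompact_of_isCompact {X : Type*} [TopologicalSpace X]
    [TopologicalSpace.MetrizableSpace X] {K : Set X} (hK : IsCompact K) :
    SelSeqPseudocompact K := by
  intro U _ hU
  choose x hx using hU
  have := isCompact_iff_compactSpace.1 hK
  obtain ⟨l, φ, hφ, hl⟩ := CompactSpace.tendsto_subseq x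
  exact ⟨x, fun n => (hx n).1, φ, hφ, l, hl⟩

/-! ### Total boundedness from selective sequential pseudocompactness -/

section Precompactness

variable {𝕜 : Type*} [RCLike 𝕜] {Z ι : Type*} [TopologicalSpace Z]

/-- A family of functions for which convergent sequences of points have uniformly convergent
values. -/
def UniformlySeqContinuous (f : ι → C(Z, 𝕜)) : Prop :=
  ∀ (x : ℕ → Z) (l : Z), Tendsto x atTop (𝓝 l) →
    ∀ ε > 0, ∀ᶠ n in atTop, ∀ i, ‖f i (x n) - f i l‖ < ε

namespace UniformlySeqContinuous

variable {f : ι → C(Z, 𝕜)}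

/-- Two terms of a convergent subsequence of selected points are both uniformly within `ε / 2` of
the limit. -/
theorem exists_lt_forall_norm_sub_lt (hf : UniformlySeqContinuous f)
    (hZ : SelSeqPseudocompact Z) {U : ℕ → Set Z} (hUo : ∀ n, IsOpen (U n))
    (hUne : ∀ n, (U n).Nonempty) {ε : ℝ} (hε : 0 < ε) :
    ∃ n m, n < m ∧ ∃ x ∈ U n, ∃ y ∈ U m, ∀ i, ‖f i x - f i y‖ < ε := by
  obtain ⟨x, hx, φ, hφ, l, hl⟩ := hZ U hUo (by simpa using hUne)
  obtain ⟨N, hN⟩ := eventually_atTop.1 (hf _ l hl (ε / 2) (half_pos hε))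
  refine ⟨φ N, φ (N + 1), hφ N.lt_succ_self, _, hx _, _, hx _, fun i => ?_⟩
  have h1 := hN N le_rfl i
  have h2 := hN (N + 1) N.le_succ i
  rw [norm_sub_rev] at h2
  refine (norm_sub_le_norm_sub_add_norm_sub _ (f i l) _).trans_lt ?_
  simp only [Function.comp_apply] at h1 h2
  linarith

/-- Every nonempty open set contains a nonempty open set on which the whole family oscillates
little. -/
theorem exists_isOpen_subset_norm_sub_le (hf : UniformlySeqContinuous f)
    (hZ : SelSeqPseudocompact Z) {V : Set Z} (hVo : IsOpen V) (hVne : V.Nonempty) {ε : ℝ}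
    (hε : 0 < ε) :
    ∃ W ⊆ V, IsOpen W ∧ W.Nonempty ∧ ∀ x ∈ W, ∀ y ∈ W, ∀ i, ‖f i x - f i y‖ ≤ ε := by
  by_contra! hcon
  -- Otherwise each `W` contains nonempty open sets `U` and `W'` on which some `f i` differs by more
  -- than `ε`. Iterating on `W'` gives sets `U` that are pairwise separated, as the later ones lie
  -- in `W'`.
  have hsplit : ∀ W : {W : Set Z // W ⊆ V ∧ IsOpen W ∧ W.Nonempty},
      ∃ (W' : {W : Set Z // W ⊆ V ∧ IsOpen W ∧ W.Nonempty}) (U : Set Z) (i : ι),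
        W'.1 ⊆ W.1 ∧ U ⊆ W.1 ∧ IsOpen U ∧ U.Nonempty ∧
        ∀ x ∈ U, ∀ y ∈ W'.1, ε < ‖f i x - f i y‖ := by
    rintro ⟨W, hWV, hWo, hWne⟩
    obtain ⟨x, hx, y, hy, i, hi⟩ := hcon W hWV hWo hWne
    have hopen : IsOpen {p : Z × Z | ε < ‖f i p.1 - f i p.2‖} :=
      isOpen_lt continuous_const (by fun_prop)
    obtain ⟨u, v, hu, hv, hxu, hyv, huv⟩ := isOpen_prod_iff.1 hopen x y hi
    exact ⟨⟨W ∩ v, Set.inter_subset_left.trans hWV, hWo.inter hv, y, hy, hyv⟩, W ∩ u, i,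
      Set.inter_subset_left, Set.inter_subset_left, hWo.inter hu, ⟨x, hx, hxu⟩,
      fun a ha b hb => huv (Set.mk_mem_prod ha.2 hb.2)⟩
  choose next U i hnext hUW hUo hUne hsep using hsplit
  let W : ℕ → {W : Set Z // W ⊆ V ∧ IsOpen W ∧ W.Nonempty} :=
    fun n => next^[n] ⟨V, subset_rfl, hVo, hVne⟩
  have hWsucc : ∀ n, W (n + 1) = next (W n) := fun n => Function.iterate_succ_apply' _ _ _
  have hanti : Antitone fun n => (W n).1 := antitone_nat_of_succ_le fun n => by
    rw [hWsucc]
    exact hnext _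
  obtain ⟨n, m, hnm, x, hx, y, hy, hxy⟩ := hf.exists_lt_forall_norm_sub_lt hZ
    (fun n => hUo (W n)) (fun n => hUne (W n)) hε
  have hy' : y ∈ (next (W n)).1 := by
    rw [← hWsucc]
    exact hanti (Nat.succ_le_of_lt hnm) (hUW _ hy)
  exact lt_asymm (hxy _) (hsep _ x hx y hy')

/-- On a selectively sequentially pseudocompact space, the pseudometric of uniform distance of
the values of the family is totally bounded. -/
theorem exists_finset_forall_norm_sub_le (hf : UniformlySeqContinuous f)
    (hZ : SelSeqPseudocompact Z) {ε : ℝ} (hε : 0 < ε) :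
    ∃ P : Finset Z, ∀ y, ∃ p ∈ P, ∀ i, ‖f i y - f i p‖ ≤ ε := by
  classical
  by_contra! hcon
  -- Only points of open sets can be selected, not prescribed ones. So each point `w.2` of an
  -- `ε`-separated sequence comes with an open set `w.1` of oscillation at most `ε / 2`, and every
  -- point of a later set is `ε`-far from `w.2`.
  obtain ⟨w, hw, hsep⟩ := exists_seq_of_forall_finset_exists
    (fun w : Set Z × Z => IsOpen w.1 ∧ w.2 ∈ w.1 ∧
      ∀ x ∈ w.1, ∀ y ∈ w.1, ∀ i, ‖f i x - f i y‖ ≤ ε / 2)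
    (fun w w' => ∀ y ∈ w'.1, ∃ i, ε < ‖f i y - f i w.2‖) (fun s _ => by
      have hopen : IsOpen (⋂ w ∈ s, ⋃ i, {y | ε < ‖f i y - f i w.2‖}) :=
        isOpen_biInter_finset fun w _ => isOpen_iUnion fun i =>
          isOpen_lt continuous_const (by fun_prop)
      obtain ⟨y, hy⟩ := hcon (s.image Prod.snd)
      obtain ⟨W, hWsub, hWo, ⟨p, hp⟩, hW⟩ := hf.exists_isOpen_subset_norm_sub_le hZ hopen
        ⟨y, Set.mem_iInter₂.2 fun w hw =>
          Set.mem_iUnion.2 (hy w.2 (Finset.mem_image_of_mem _ hw))⟩ (half_pos hε)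
      exact ⟨(W, p), ⟨hWo, hp, hW⟩, fun w hw z hz =>
        Set.mem_iUnion.1 (Set.mem_iInter₂.1 (hWsub hz) w hw)⟩)
  obtain ⟨n, m, hnm, x, hx, y, hy, hxy⟩ := hf.exists_lt_forall_norm_sub_lt hZ
    (fun n => (hw n).1) (fun n => ⟨_, (hw n).2.1⟩) (half_pos hε)
  obtain ⟨i, hi⟩ := hsep n m hnm y hy
  have h1 := hxy i
  have h2 := (hw n).2.2 x hx _ (hw n).2.1 i
  rw [norm_sub_rev] at h1
  have h3 := norm_sub_le_norm_sub_add_norm_sub (f i y) (f i x) (f i (w n).2)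
  linarith

/-- On a selectively sequentially pseudocompact space, a pointwise bounded uniformly sequentially
continuous family is totally bounded for the uniform distance. -/
theorem exists_finite_forall_norm_sub_le (hf : UniformlySeqContinuous f)
    (hZ : SelSeqPseudocompact Z) (hb : ∀ z, ∃ C, ∀ i, ‖f i z‖ ≤ C) {ε : ℝ} (hε : 0 < ε) :
    ∃ F : Set ι, F.Finite ∧ ∀ i, ∃ j ∈ F, ∀ z, ‖f i z - f j z‖ ≤ ε := by
  obtain ⟨P, hP⟩ := hf.exists_finset_forall_norm_sub_le hZ (ε := ε / 3) (by positivity)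
  let Φ : ι → P → 𝕜 := fun i p => f i p
  -- Values on the finite net `P` form a bounded set in a finite-dimensional space.
  have htb : TotallyBounded (Set.range Φ) := by
    refine (Bornology.IsBounded.isCompact_closure (Bornology.forall_isBounded_image_eval_iff.1
      fun p => ?_)).totallyBounded.subset subset_closure
    obtain ⟨C, hC⟩ := hb p
    refine isBounded_iff_forall_norm_le.2 ⟨C, ?_⟩
    rintro _ ⟨_, ⟨i, rfl⟩, rfl⟩
    exact hC i
  obtain ⟨t, ht, htf, hcov⟩ := Metric.finite_approx_of_totallyBounded htb (ε / 3) (by positivity)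
  choose j hj using fun q : t => ht q.2
  have := htf.to_subtype
  refine ⟨Set.range j, Set.finite_range j, fun i => ?_⟩
  obtain ⟨q, hqt, hq⟩ := Set.mem_iUnion₂.1 (hcov (Set.mem_range_self i))
  refine ⟨j ⟨q, hqt⟩, Set.mem_range_self _, fun z => ?_⟩
  obtain ⟨p, hp, hzp⟩ := hP z
  have h1 := hzp i
  have h2 := hzp (j ⟨q, hqt⟩)
  have h3 : ‖f i p - f (j ⟨q, hqt⟩) p‖ < ε / 3 := by
    rw [show q = Φ (j ⟨q, hqt⟩) from (hj ⟨q, hqt⟩).symm, mem_ball_iff_norm] at hq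
    exact (norm_le_pi_norm (Φ i - Φ (j ⟨q, hqt⟩)) ⟨p, hp⟩).trans_lt hq
  rw [norm_sub_rev] at h2
  have h4 := norm_sub_le_norm_sub_add_norm_sub (f i z) (f i p) (f (j ⟨q, hqt⟩) z)
  have h5 := norm_sub_le_norm_sub_add_norm_sub (f i p) (f (j ⟨q, hqt⟩) p) (f (j ⟨q, hqt⟩) z)
  linarith

end UniformlySeqContinuous

end Precompactness

/-! ### The Gelfand–Phillips property -/

section GelfandPhillips

variable {𝕜 : Type*} [RCLike 𝕜] {X : Type*} [TopologicalSpace X]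
  {E : Type*} [AddCommGroup E] [Module 𝕜 E] [Module ℝ E] [IsScalarTower ℝ 𝕜 E]
  [TopologicalSpace E]

theorem isBarrel_closedBall_one : IsBarrel 𝕜 (Metric.closedBall (0 : 𝕜) 1) where
  isClosed := Metric.isClosed_closedBall
  balanced := balanced_closedBall_zero
  convex := convex_closedBall _ _
  absorbent := absorbent_nhds_zero (Metric.closedBall_mem_nhds _ one_pos)

/-- A barrel-bounded set is bounded under every continuous linear functional. -/
theorem BarrelBounded.exists_norm_le {A : Set E} (hA : BarrelBounded 𝕜 A) (χ : E →L[𝕜] 𝕜) :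
    ∃ C : ℝ, ∀ v ∈ A, ‖χ v‖ ≤ C := by
  obtain ⟨n, hn⟩ := hA _ (isBarrel_closedBall_one.preimage χ.toLinearMap χ.continuous)
  refine ⟨n, fun v hv => ?_⟩
  obtain ⟨w, hw, rfl⟩ := hn hv
  have hw' : ‖χ w‖ ≤ 1 := by simpa using hw
  simpa [norm_mul] using mul_le_mul_of_nonneg_left hw' (Nat.cast_nonneg (α := ℝ) n)

/-- The Gelfand--Phillips property of the continuous functions on a `μ`-space with selectively
sequentially pseudocompact compact subsets, for each vector topology between those of
pointwise convergence and of compact convergence. -/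
theorem gelfandPhillips_of_linearEquiv [CompletelyRegularSpace X]
    (hX : IsMuSpace X)
    (hK : ∀ K : Set X, IsCompact K → SelSeqPseudocompact K) (e : C(X, 𝕜) ≃ₗ[𝕜] E)
    (he : Continuous e) (hev : ∀ x, Continuous fun v => e.symm v x) : GelfandPhillips 𝕜 E := by
  rintro A ⟨hbdd, hlim⟩ U hU
  obtain ⟨K, hKc, ε, hε, hKU⟩ :=
    (hU.preimage e.toLinearMap he).exists_isCompact_of_isMuSpace hX
  let ev : X → E →L[𝕜] 𝕜 := fun x =>
    { toFun := fun v => e.symm v x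
      map_add' := fun v w => by simp
      map_smul' := fun c v => by simp
      cont := hev x }
  let f : A → C(K, 𝕜) := fun v => (e.symm v.1).restrict K
  have hf : UniformlySeqContinuous f := by
    intro x l hx δ hδ
    -- Weak* null because each function is continuous at `l`; limitedness turns this into uniform
    -- convergence on `A`.
    let χ : ℕ → WeakDual 𝕜 E := fun n => StrongDual.toWeakDual (ev (x n) - ev l)
    have hχ : Tendsto χ atTop (𝓝 0) := by
      rw [tendsto_iff_forall_eval_tendsto_topDualPairing]
      intro v
      have h : Tendsto (fun n => e.symm v (x n) - e.symm v l) atTop (𝓝 (0 : 𝕜)) := by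
        have h' := (((e.symm v).continuous.comp continuous_subtype_val).tendsto l).comp hx
        simpa using h'.sub_const (e.symm v l)
      exact h
    filter_upwards [Metric.tendstoUniformlyOn_iff.1 (hlim χ hχ) δ hδ] with n hn v
    have := hn v.1 v.2
    rw [dist_zero_left] at this
    exact this
  obtain ⟨F, hF, hFA⟩ := hf.exists_finite_forall_norm_sub_le (hK K hKc) (fun z => by
    obtain ⟨C, hC⟩ := hbdd.exists_norm_le (ev z)
    exact ⟨C, fun v => hC v.1 v.2⟩) (half_pos hε)
  refine ⟨Subtype.val '' F, hF.image _, fun v hv => ?_⟩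
  obtain ⟨w, hw, hvw⟩ := hFA ⟨v, hv⟩
  refine Set.mem_add.2 ⟨w, Set.mem_image_of_mem _ hw, v - w, ?_, add_sub_cancel _ _⟩
  have := hKU (e.symm v - e.symm w) fun x hx =>
    (hvw ⟨x, hx⟩).trans_lt (half_lt_self hε)
  simpa using this

/-- The identity map from the compact-open topology to the topology of pointwise convergence. -/
def ckEquivCp (𝕜 X : Type*) [RCLike 𝕜] [TopologicalSpace X] : Ck X 𝕜 ≃ₗ[𝕜] Cp X 𝕜 where
  toFun f := ⟨f, f.continuous⟩
  invFun f := ⟨f.1, f.2⟩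
  map_add' _ _ := rfl
  map_smul' _ _ := rfl
  left_inv _ := rfl
  right_inv _ := rfl

theorem continuous_ckEquivCp (𝕜 X : Type*) [RCLike 𝕜] [TopologicalSpace X] :
    Continuous (ckEquivCp 𝕜 X) :=
  (continuous_pi fun x => continuous_eval_const x).subtype_mk _

end GelfandPhillips

theorem corollary3p6 (𝕜 : Type*) [RCLike 𝕜] (X : Type*) [TopologicalSpace X] [T35Space X] :
    (IsMuSpace X → (∀ K : Set X, IsCompact K → SelSeqPseudocompact K) →
      GelfandPhillips 𝕜 (Cp X 𝕜) ∧ GelfandPhillips 𝕜 (Ck X 𝕜)) ∧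
    (TopologicalSpace.MetrizableSpace X →
      IsMuSpace X ∧ ∀ K : Set X, IsCompact K → SelSeqPseudocompact K) :=
  ⟨fun hX hK =>
    ⟨gelfandPhillips_of_linearEquiv hX hK (ckEquivCp 𝕜 X) (continuous_ckEquivCp 𝕜 X)
      fun x => (continuous_apply x).comp continuous_subtype_val,
    gelfandPhillips_of_linearEquiv hX hK (LinearEquiv.refl 𝕜 (Ck X 𝕜)) continuous_id
      fun x => continuous_eval_const x⟩,
  fun _ => ⟨isMuSpace_of_metrizableSpace X, fun _ hK => selSeqPseudocompact_of_isCompact hK⟩⟩
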